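/- Let $d\ge 1$ be an integer. For $f,g\in L^2(\mathbb R^d)$ (complex-valued) put $(f\otimes g)(x,y)=f(x)g(y)$, an element of $L^2(\mathbb R^d\times\mathbb R^d)$, and let $\mathbb P$ be the orthogonal projection of $L^2(\mathbb R^d\times\mathbb R^d)$ onto the closed subspace of radially symmetric functions, i.e. those of the form $F(x,y)=h\big((|x|^2+|y|^2)^{1/2}\big)$ almost everywhere with $h$ measurable. For a measurable function $f$ on $\mathbb R^d$ let $f^*(t)=\inf\{s\ge 0: |\{x:|f(x)|>s\}|\le t\}$, $t>0$, be its decreasing rearrangement, and let $$\|f\|_{L^{2,4}}=\Big(\tfrac{4}{2}\int_0^\infty \big[t^{1/2}f^*(t)\big]^4\,\frac{dt}{t}\Big)^{1/4}$$ be its Lorentz (quasi-)norm. Then for every $d\ge 1$ there exists a constant $C<\infty$, depending only on $d$, such that for all $f,g\in L^2(\mathbb R^d)$, $$\|\mathbb P(f\otimes g)\|_{L^2(\mathbb R^d\times\mathbb R^d)}\le C\,\|f\|_{L^{2,4}}\,\|g\|_{L^{2,4}}.$$ -/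

import Mathlib

open MeasureTheory
open scoped ENNReal NNReal

noncomputable section

namespace NearlyRadial

/-- `ℝ^d` with its Euclidean norm and Lebesgue measure. -/
abbrev Rd (d : ℕ) : Type := EuclideanSpace ℝ (Fin d)

/-- The Hilbert space `L²(ℝ^d)` of complex-valued functions. -/
abbrev L2 (d : ℕ) : Type := Lp ℂ 2 (volume : Measure (Rd d))

/-- The Hilbert space `L²(ℝ^d × ℝ^d)` with respect to Lebesgue (product) measure. -/
abbrev L2Prod (d : ℕ) : Type := Lp ℂ 2 (volume : Measure (Rd d × Rd d))

/-- The Euclidean norm `|(x,y)| = (|x|² + |y|²)^{1/2}` on `ℝ^d × ℝ^d = ℝ^{2d}`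
(Lean's own norm on a product type is the maximum norm). -/
def radius {d : ℕ} (z : Rd d × Rd d) : ℝ := √(‖z.1‖ ^ 2 + ‖z.2‖ ^ 2)

theorem measurable_radius {d : ℕ} : Measurable (radius (d := d)) := by
  unfold radius
  fun_prop

/-! ### The tensor product -/

theorem memLp_tensor {d : ℕ} (f g : L2 d) :
    MemLp (fun z : Rd d × Rd d => f z.1 * g z.2) 2 volume := by
  have hf := Lp.memLp f
  have hg := Lp.memLp g
  have hm : AEStronglyMeasurable (fun z : Rd d × Rd d => f z.1 * g z.2) volume := by
    rw [Measure.volume_eq_prod]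
    exact hf.1.comp_fst.mul hg.1.comp_snd
  rw [memLp_two_iff_integrable_sq_norm hm]
  have h := ((memLp_two_iff_integrable_sq_norm hf.1).1 hf).mul_prod
    ((memLp_two_iff_integrable_sq_norm hg.1).1 hg)
  rw [← Measure.volume_eq_prod] at h
  refine h.congr (Filter.Eventually.of_forall fun z => ?_)
  simp [mul_pow]

/-- The tensor product `(f ⊗ g)(x,y) = f(x) g(y)`, as an element of `L²(ℝ^d × ℝ^d)`. -/
def tensor {d : ℕ} (f g : L2 d) : L2Prod d := (memLp_tensor f g).toLp _

/-! ### Radially symmetric functions and the projection onto them -/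

/-- The subspace of `L²(ℝ^d × ℝ^d)` of radially symmetric functions: those of the form
`z ↦ h(|z|)` almost everywhere, for some measurable `h`. -/
def radialSubspace (d : ℕ) : Submodule ℂ (L2Prod d) where
  carrier := {F | ∃ h : ℝ → ℂ, Measurable h ∧ ∀ᵐ z, F z = h (radius z)}
  zero_mem' := by
    refine ⟨0, measurable_zero, ?_⟩
    filter_upwards [Lp.coeFn_zero ℂ 2 (volume : Measure (Rd d × Rd d))] with z hz
    exact hz
  add_mem' := by
    rintro F G ⟨h, hm, hF⟩ ⟨k, km, hG⟩
    refine ⟨h + k, hm.add km, ?_⟩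
    filter_upwards [hF, hG, Lp.coeFn_add F G] with z h1 h2 h3
    rw [h3, Pi.add_apply, h1, h2, Pi.add_apply]
  smul_mem' := by
    rintro c F ⟨h, hm, hF⟩
    refine ⟨c • h, hm.const_smul c, ?_⟩
    filter_upwards [hF, Lp.coeFn_smul c F] with z h1 h2
    rw [h2, Pi.smul_apply, h1, Pi.smul_apply]

theorem radialSubspace_eq_lpMeas (d : ℕ) :
    radialSubspace d = lpMeas ℂ ℂ (MeasurableSpace.comap (radius (d := d)) inferInstance) 2
      (volume : Measure (Rd d × Rd d)) := by
  ext F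
  rw [mem_lpMeas_iff_aestronglyMeasurable]
  constructor
  · rintro ⟨h, hm, hF⟩
    exact ⟨fun z => h (radius z),
      (hm.comp (comap_measurable (radius (d := d)))).stronglyMeasurable, hF⟩
  · rintro ⟨G, hG, hFG⟩
    obtain ⟨h, hm, rfl⟩ := hG.measurable.exists_eq_measurable_comp
    exact ⟨h, hm, hFG⟩

/-- The radially symmetric functions form a closed subspace, so that the orthogonal projection
onto them exists. -/
instance hasOrthogonalProjection_radialSubspace (d : ℕ) :
    (radialSubspace d).HasOrthogonalProjection := by
  rw [radialSubspace_eq_lpMeas]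
  have : Fact (MeasurableSpace.comap (radius (d := d)) inferInstance ≤
      (inferInstance : MeasurableSpace (Rd d × Rd d))) := ⟨measurable_radius.comap_le⟩
  infer_instance

/-- The orthogonal projection `P` of `L²(ℝ^d × ℝ^d)` onto the subspace of radially symmetric
functions. -/
def radialProj (d : ℕ) : L2Prod d →L[ℂ] L2Prod d := (radialSubspace d).starProjection

/-! ### Lorentz spaces -/

/-- The decreasing rearrangement `f*(t) = inf {s ≥ 0 : μ {x : |f(x)| > s} ≤ t}`, for `t > 0`. -/
def decreasingRearrangement {α : Type*} [MeasurableSpace α] (μ : Measure α) (f : α → ℂ)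
    (t : ℝ) : ℝ≥0∞ :=
  sInf {s : ℝ≥0∞ | μ {x | s < ‖f x‖ₑ} ≤ ENNReal.ofReal t}

/-- The Lorentz (quasi-)norm
`‖f‖_{L^{p,q}} = ( (q/p) ∫_0^∞ [t^{1/p} f*(t)]^q dt/t )^{1/q}`, for `0 < p, q < ∞`. -/
def lorentzNorm {α : Type*} [MeasurableSpace α] (p q : ℝ) (μ : Measure α) (f : α → ℂ) : ℝ≥0∞ :=
  (ENNReal.ofReal (q / p) *
    ∫⁻ t in Set.Ioi (0 : ℝ),
      (ENNReal.ofReal (t ^ (1 / p)) * decreasingRearrangement μ f t) ^ q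
        * ENNReal.ofReal (1 / t)) ^ (1 / q)

end NearlyRadial

end

open Filter Topology

namespace NearlyRadial

/-! ### Rotations mixing the two factors -/

/-! Split `f` and `g` at the heights of their decreasing rearrangements at the points `4 ^ j`. The
piece of `f` of index `j` has height at most `f*(4 ^ j)` and support of measure at most `4 ^ (j +
1)`, and the ℓ⁴ norm of `weight f j = 2 ^ j * f*(4 ^ j)` is controlled by the L^{2,4} norm.
Expanding the square of the norm of the projection gives a four-fold sum of inner products of
projected tensors, of indices `(j, k)` and `(l, m)`. Two independent gains make it summable.

The first is decay in `|j - k|`. Rotations mixing `x` and `y` do not change the radial projection,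
so a function may be replaced by an average of its rotates. Rotates of a function living on `E × E'`
are nearly orthogonal when `E` and `E'` have very different measures (`sq_enorm_radialProj_le`).

The second is decay in `|j + k - l - m|`. The projection is a contraction in the uniform norm, so
the inner product of two projections is at most the L¹ norm of one function times the uniform norm
of the other (`enorm_inner_radialProj_le`).

Together they give geometric decay in `j - k`, `j - l` and `l - m`
(`enorm_inner_radialProj_tensor_piece_le_pow`). With these three differences fixed, Hölder's
inequality in the remaining index leaves exactly the ℓ⁴ norms of the weights (`tsum_four_le`). -/

/-- The rotation by the angle `θ` in each coordinate plane `(x_i, y_i)` of `ℝ^d × ℝ^d`. -/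
noncomputable def rot (d : ℕ) (θ : ℝ) (z : Rd d × Rd d) : Rd d × Rd d :=
  (Real.cos θ • z.1 - Real.sin θ • z.2, Real.sin θ • z.1 + Real.cos θ • z.2)

theorem rot_rot {d : ℕ} (a b : ℝ) (z : Rd d × Rd d) : rot d a (rot d b z) = rot d (a + b) z := by
  simp only [rot, Real.cos_add, Real.sin_add]
  ext1 <;> module

theorem rot_zero {d : ℕ} (z : Rd d × Rd d) : rot d 0 z = z := by
  simp [rot]

theorem radius_sq_rot {d : ℕ} (θ : ℝ) (z : Rd d × Rd d) :
    ‖(rot d θ z).1‖ ^ 2 + ‖(rot d θ z).2‖ ^ 2 = ‖z.1‖ ^ 2 + ‖z.2‖ ^ 2 := by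
  simp only [rot]
  rw [norm_sub_sq_real, norm_add_sq_real]
  simp only [norm_smul, inner_smul_left, inner_smul_right, mul_pow, Real.norm_eq_abs, sq_abs,
    conj_trivial]
  linear_combination (‖z.1‖ ^ 2 + ‖z.2‖ ^ 2) * Real.sin_sq_add_cos_sq θ

theorem radius_rot {d : ℕ} (θ : ℝ) (z : Rd d × Rd d) : radius (rot d θ z) = radius z := by
  rw [radius, radius_sq_rot, radius]

/-- The rotation as a linear isometry of the Euclidean product. -/
noncomputable def rotIsometry (d : ℕ) (θ : ℝ) :
    WithLp 2 (Rd d × Rd d) ≃ₗᵢ[ℝ] WithLp 2 (Rd d × Rd d) where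
  toFun z := WithLp.toLp 2 (rot d θ z.ofLp)
  invFun z := WithLp.toLp 2 (rot d (-θ) z.ofLp)
  left_inv z := by simp [rot_rot, rot_zero]
  right_inv z := by simp [rot_rot, rot_zero]
  map_add' z w := by
    apply (WithLp.ofLp_injective 2)
    simp only [rot, WithLp.ofLp_add, Prod.fst_add, Prod.snd_add]
    ext1 <;> simp only [Prod.fst_add, Prod.snd_add] <;> module
  map_smul' c z := by
    apply (WithLp.ofLp_injective 2)
    simp only [rot, WithLp.ofLp_smul, Prod.smul_fst, Prod.smul_snd, RingHom.id_apply]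
    ext1 <;> simp only [Prod.smul_fst, Prod.smul_snd] <;> module
  norm_map' z := by
    rw [WithLp.prod_norm_eq_of_L2, WithLp.prod_norm_eq_of_L2]
    exact congrArg Real.sqrt (radius_sq_rot θ z.ofLp)

theorem measurePreserving_rot (d : ℕ) (θ : ℝ) : MeasurePreserving (rot d θ) volume volume :=
  (WithLp.volume_preserving_ofLp (Rd d) (Rd d)).comp
    ((rotIsometry d θ).measurePreserving.comp (WithLp.volume_preserving_toLp (Rd d) (Rd d)))

/-- The composition with a rotation, as an isometry of `L²(ℝ^d × ℝ^d)`. -/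
noncomputable def rotL2 (d : ℕ) (θ : ℝ) : L2Prod d →ₗᵢ[ℂ] L2Prod d :=
  Lp.compMeasurePreservingₗᵢ ℂ (rot d θ) (measurePreserving_rot d θ)

theorem coeFn_rotL2 {d : ℕ} (θ : ℝ) (F : L2Prod d) : rotL2 d θ F =ᵐ[volume] F ∘ rot d θ :=
  Lp.coeFn_compMeasurePreserving F (measurePreserving_rot d θ)

theorem rotL2_rotL2 {d : ℕ} (a b : ℝ) (F : L2Prod d) :
    rotL2 d a (rotL2 d b F) = rotL2 d (b + a) F := by
  apply Lp.ext
  have h := (measurePreserving_rot d a).quasiMeasurePreserving.ae_eq_comp (coeFn_rotL2 b F)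
  filter_upwards [coeFn_rotL2 a (rotL2 d b F), coeFn_rotL2 (b + a) F, h] with z h1 h2 h3
  rw [h1, h2, h3]
  simp [rot_rot]

theorem rotL2_zero {d : ℕ} (F : L2Prod d) : rotL2 d 0 F = F := by
  apply Lp.ext
  filter_upwards [coeFn_rotL2 0 F] with z h1
  rw [h1, Function.comp_apply, rot_zero]

theorem rotL2_of_mem_radialSubspace {d : ℕ} (θ : ℝ) {F : L2Prod d} (hF : F ∈ radialSubspace d) :
    rotL2 d θ F = F := by
  obtain ⟨h, -, hF⟩ := hF
  apply Lp.ext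
  have h' := (measurePreserving_rot d θ).quasiMeasurePreserving.ae hF
  filter_upwards [coeFn_rotL2 θ F, hF, h'] with z h1 h2 h3
  rw [h1, h2, Function.comp_apply, h3, radius_rot]

/-! ### Averaging over rotations -/

theorem radialProj_mem {d : ℕ} (F : L2Prod d) : radialProj d F ∈ radialSubspace d :=
  Submodule.starProjection_apply_mem _ _

/-- Rotations are isometries fixing every radial function, so they preserve orthogonality to the
radial subspace. -/
theorem radialProj_rotL2 {d : ℕ} (θ : ℝ) (F : L2Prod d) :
    radialProj d (rotL2 d θ F) = radialProj d F := by
  refine Submodule.eq_starProjection_of_mem_of_inner_eq_zero (radialProj_mem F) fun w hw => ?_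
  rw [← rotL2_of_mem_radialSubspace θ (radialProj_mem F), ← rotL2_of_mem_radialSubspace θ hw,
    ← map_sub, LinearIsometry.inner_map_map]
  exact Submodule.starProjection_inner_eq_zero _ _ hw

theorem enorm_inner_le_lintegral {α : Type*} [MeasurableSpace α] {μ : Measure α}
    (F G : Lp ℂ 2 μ) : ‖inner ℂ F G‖ₑ ≤ ∫⁻ z, ‖F z‖ₑ * ‖G z‖ₑ ∂μ := by
  rw [L2.inner_def]
  refine (enorm_integral_le_lintegral_enorm _).trans (lintegral_mono fun z => ?_)
  rw [RCLike.inner_apply, enorm_mul, mul_comm]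
  simp [enorm_eq_nnnorm]

/-- The projection of `F` is bounded by the autocorrelation of `F` under finitely many
rotations. -/
theorem sq_enorm_radialProj_le_sum {d : ℕ} (F : L2Prod d) (N : ℕ) (θ : ℕ → ℝ) :
    (N : ℝ≥0∞) ^ 2 * ‖radialProj d F‖ₑ ^ 2 ≤
      ∑ k ∈ Finset.range N, ∑ l ∈ Finset.range N, ‖inner ℂ F (rotL2 d (θ l - θ k) F)‖ₑ := by
  set S := ∑ k ∈ Finset.range N, rotL2 d (θ k) F with hS
  have h1 : radialProj d S = (N : ℂ) • radialProj d F := by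
    rw [hS, map_sum]
    simp [radialProj_rotL2, Nat.cast_smul_eq_nsmul]
  have h2 : ‖(N : ℂ) • radialProj d F‖ₑ ≤ ‖S‖ₑ := by
    rw [← h1, enorm_le_iff_norm_le]
    exact Submodule.norm_starProjection_apply_le _ _
  have h3 : ‖S‖ₑ ^ 2 = ‖inner ℂ S S‖ₑ := by
    rw [inner_self_eq_norm_sq_to_K, enorm_pow]
    simp [enorm_eq_nnnorm]
  calc (N : ℝ≥0∞) ^ 2 * ‖radialProj d F‖ₑ ^ 2 = ‖(N : ℂ) • radialProj d F‖ₑ ^ 2 := by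
        have hN : ‖(N : ℂ)‖ₑ = N := by
          rw [← ofReal_norm, Complex.norm_natCast, ENNReal.ofReal_natCast]
        rw [enorm_smul, mul_pow, hN]
    _ ≤ ‖inner ℂ S S‖ₑ := by rw [← h3]; gcongr
    _ ≤ _ := by
        rw [hS, sum_inner]
        refine (enorm_sum_le _ _).trans (Finset.sum_le_sum fun k _ => ?_)
        rw [inner_sum]
        refine (enorm_sum_le _ _).trans (Finset.sum_le_sum fun l _ => ?_)
        -- Undoing the rotation by `θ k` in both arguments leaves only the difference of the angles.
        rw [← (rotL2 d (θ k)).inner_map_map F, rotL2_rotL2, sub_add_cancel]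

theorem volume_preimage_affine {d : ℕ} {s : ℝ} (hs : s ≠ 0) (v : Rd d) (E : Set (Rd d)) :
    volume {y : Rd d | v + s • y ∈ E} = ENNReal.ofReal (|s|⁻¹ ^ d) * volume E := by
  have h : {y : Rd d | v + s • y ∈ E} = (s • ·) ⁻¹' ((v + ·) ⁻¹' E) := rfl
  rw [h, Measure.addHaar_preimage_smul volume hs, measure_preimage_add]
  simp [abs_inv, abs_pow]

/-! ### Decay for functions dominated by indicators of product sets -/

/-- For fixed `x` the map in `y` is a translate of a dilation by `s`, so the inner integral does not
depend on `x`. -/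
theorem lintegral_indicator_mul_preimage_affine {d : ℕ} (c : ℝ) {s : ℝ} (hs : s ≠ 0)
    {E : Set (Rd d)} (hE : MeasurableSet E) :
    ∫⁻ x, ∫⁻ y, E.indicator 1 x * E.indicator (1 : Rd d → ℝ≥0∞) (c • x + s • y) =
      ENNReal.ofReal (|s|⁻¹ ^ d) * volume E ^ 2 := by
  have h : ∀ x, ∫⁻ y, E.indicator 1 x * E.indicator (1 : Rd d → ℝ≥0∞) (c • x + s • y) =
      E.indicator 1 x * (ENNReal.ofReal (|s|⁻¹ ^ d) * volume E) := by
    intro x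
    have hm : Measurable fun y : Rd d => c • x + s • y := by fun_prop
    have h1 : ∫⁻ y, E.indicator (1 : Rd d → ℝ≥0∞) (c • x + s • y) =
        volume {y | c • x + s • y ∈ E} := lintegral_indicator_one (hm hE)
    have h2 : Measurable fun y => E.indicator (1 : Rd d → ℝ≥0∞) (c • x + s • y) :=
      (measurable_one.indicator hE).comp hm
    rw [lintegral_const_mul _ h2, h1, volume_preimage_affine hs]
  simp_rw [h]
  rw [lintegral_mul_const _ (measurable_one.indicator hE), lintegral_indicator_one hE]
  ring

theorem ae_comp_rot {d : ℕ} (θ : ℝ) {p : Rd d × Rd d → Prop} (h : ∀ᵐ z, p z) :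
    ∀ᵐ z, p (rot d θ z) :=
  (measurePreserving_rot d θ).quasiMeasurePreserving.ae h

section

variable {d : ℕ} {F : L2Prod d} {A : ℝ≥0∞} {E E' : Set (Rd d)}

theorem enorm_inner_rotL2_le_lintegral (θ : ℝ) :
    ‖inner ℂ F (rotL2 d θ F)‖ₑ ≤ ∫⁻ z, ‖F z‖ₑ * ‖F (rot d θ z)‖ₑ := by
  refine (enorm_inner_le_lintegral _ _).trans (lintegral_mono_ae ?_)
  filter_upwards [coeFn_rotL2 θ F] with z hz
  rw [hz, Function.comp_apply]

theorem indicator_one_mul_le_left (z w : Rd d) :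
    E.indicator (1 : Rd d → ℝ≥0∞) z * E'.indicator 1 w ≤ E.indicator 1 z :=
  mul_le_of_le_one_right' (Set.indicator_le_self' (by simp) _)

theorem indicator_one_mul_le_right (z w : Rd d) :
    E.indicator (1 : Rd d → ℝ≥0∞) z * E'.indicator 1 w ≤ E'.indicator 1 w :=
  mul_le_of_le_one_left' (Set.indicator_le_self' (by simp) _)

/-- Only the constraints on first coordinates, before and after the rotation, are kept; those from
`E'` are dropped. This is efficient when `E` is the smaller set. -/
theorem enorm_inner_rotL2_le_left (hE : MeasurableSet E)
    (hF : ∀ᵐ z, ‖F z‖ₑ ≤ A * (E.indicator 1 z.1 * E'.indicator 1 z.2)) {θ : ℝ}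
    (hθ : Real.sin θ ≠ 0) :
    ‖inner ℂ F (rotL2 d θ F)‖ₑ ≤
      A ^ 2 * (ENNReal.ofReal (|Real.sin θ|⁻¹ ^ d) * volume E ^ 2) := by
  have hm : Measurable fun z : Rd d × Rd d => E.indicator 1 z.1 *
      E.indicator (1 : Rd d → ℝ≥0∞) (Real.cos θ • z.1 + (-Real.sin θ) • z.2) :=
    ((measurable_one.indicator hE).comp measurable_fst).mul
      ((measurable_one.indicator hE).comp (by fun_prop))
  calc ‖inner ℂ F (rotL2 d θ F)‖ₑ
      ≤ ∫⁻ z, ‖F z‖ₑ * ‖F (rot d θ z)‖ₑ := enorm_inner_rotL2_le_lintegral θ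
    _ ≤ ∫⁻ z : Rd d × Rd d, A ^ 2 * (E.indicator 1 z.1 *
          E.indicator (1 : Rd d → ℝ≥0∞) (Real.cos θ • z.1 + (-Real.sin θ) • z.2)) := by
        refine lintegral_mono_ae ?_
        filter_upwards [hF, ae_comp_rot θ hF] with z h1 h2
        calc ‖F z‖ₑ * ‖F (rot d θ z)‖ₑ
            ≤ (A * E.indicator 1 z.1) * (A * E.indicator 1 (rot d θ z).1) := by
              gcongr
              · exact h1.trans (mul_le_mul_right (indicator_one_mul_le_left _ _) _)
              · exact h2.trans (mul_le_mul_right (indicator_one_mul_le_left _ _) _)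
          _ = _ := by
              rw [rot, neg_smul, ← sub_eq_add_neg]
              ring
    _ = _ := by
        rw [lintegral_const_mul _ hm, Measure.volume_eq_prod, lintegral_prod _ hm.aemeasurable,
          lintegral_indicator_mul_preimage_affine _ (neg_ne_zero.2 hθ) hE, abs_neg]

theorem enorm_inner_rotL2_le_right (hE : MeasurableSet E')
    (hF : ∀ᵐ z, ‖F z‖ₑ ≤ A * (E.indicator 1 z.1 * E'.indicator 1 z.2)) {θ : ℝ}
    (hθ : Real.sin θ ≠ 0) :
    ‖inner ℂ F (rotL2 d θ F)‖ₑ ≤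
      A ^ 2 * (ENNReal.ofReal (|Real.sin θ|⁻¹ ^ d) * volume E' ^ 2) := by
  have hm : Measurable fun z : Rd d × Rd d => E'.indicator 1 z.2 *
      E'.indicator (1 : Rd d → ℝ≥0∞) (Real.cos θ • z.2 + Real.sin θ • z.1) :=
    ((measurable_one.indicator hE).comp measurable_snd).mul
      ((measurable_one.indicator hE).comp (by fun_prop))
  calc ‖inner ℂ F (rotL2 d θ F)‖ₑ
      ≤ ∫⁻ z, ‖F z‖ₑ * ‖F (rot d θ z)‖ₑ := enorm_inner_rotL2_le_lintegral θ
    _ ≤ ∫⁻ z : Rd d × Rd d, A ^ 2 * (E'.indicator 1 z.2 *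
          E'.indicator (1 : Rd d → ℝ≥0∞) (Real.cos θ • z.2 + Real.sin θ • z.1)) := by
        refine lintegral_mono_ae ?_
        filter_upwards [hF, ae_comp_rot θ hF] with z h1 h2
        calc ‖F z‖ₑ * ‖F (rot d θ z)‖ₑ
            ≤ (A * E'.indicator 1 z.2) * (A * E'.indicator 1 (rot d θ z).2) := by
              gcongr
              · exact h1.trans (mul_le_mul_right (indicator_one_mul_le_right _ _) _)
              · exact h2.trans (mul_le_mul_right (indicator_one_mul_le_right _ _) _)
          _ = _ := by
              rw [rot, add_comm (Real.cos θ • z.2)]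
              ring
    _ = _ := by
        rw [lintegral_const_mul _ hm, Measure.volume_eq_prod, lintegral_prod_symm _ hm.aemeasurable,
          lintegral_indicator_mul_preimage_affine _ hθ hE]

theorem lintegral_enorm_le_of_le_indicator (hE : MeasurableSet E) (hE' : MeasurableSet E')
    (hF : ∀ᵐ z, ‖F z‖ₑ ≤ A * (E.indicator 1 z.1 * E'.indicator 1 z.2)) :
    ∫⁻ z, ‖F z‖ₑ ≤ A * (volume E * volume E') := by
  have h1 : Measurable (E.indicator (1 : Rd d → ℝ≥0∞)) := measurable_one.indicator hE
  have h2 : Measurable (E'.indicator (1 : Rd d → ℝ≥0∞)) := measurable_one.indicator hE'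
  have hm : Measurable fun z : Rd d × Rd d =>
      E.indicator (1 : Rd d → ℝ≥0∞) z.1 * E'.indicator 1 z.2 :=
    (h1.comp measurable_fst).mul (h2.comp measurable_snd)
  refine (lintegral_mono_ae hF).trans_eq ?_
  rw [lintegral_const_mul _ hm,
    Measure.volume_eq_prod, lintegral_prod_mul h1.aemeasurable h2.aemeasurable,
    lintegral_indicator_one hE, lintegral_indicator_one hE']

theorem sq_enorm_le_of_le_indicator (hE : MeasurableSet E) (hE' : MeasurableSet E')
    (hF : ∀ᵐ z, ‖F z‖ₑ ≤ A * (E.indicator 1 z.1 * E'.indicator 1 z.2)) :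
    ‖inner ℂ F F‖ₑ ≤ A ^ 2 * (volume E * volume E') := by
  calc ‖inner ℂ F F‖ₑ ≤ ∫⁻ z, ‖F z‖ₑ * ‖F z‖ₑ := enorm_inner_le_lintegral _ _
    _ ≤ ∫⁻ z, A * ‖F z‖ₑ := by
        refine lintegral_mono_ae ?_
        filter_upwards [hF] with z h1
        gcongr
        exact h1.trans (mul_le_of_le_one_right' ((indicator_one_mul_le_left _ _).trans
          (Set.indicator_le_self' (by simp) _)))
    _ = A * ∫⁻ z, ‖F z‖ₑ := lintegral_const_mul'' _ (Lp.aestronglyMeasurable F).enorm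
    _ ≤ A * (A * (volume E * volume E')) := by
        gcongr; exact lintegral_enorm_le_of_le_indicator hE hE' hF
    _ = _ := by ring

/-- The angles `k / N` are separated by at least `1 / N` and differ by at most `1`; there Jordan's
inequality and `π ≤ 4` give `|x| / 2 ≤ |sin x|`. -/
theorem abs_sin_inv_le {N k l : ℕ} (hk : k < N) (hl : l < N) (hkl : k ≠ l) :
    Real.sin ((l : ℝ) / N - (k : ℝ) / N) ≠ 0 ∧
      |Real.sin ((l : ℝ) / N - (k : ℝ) / N)|⁻¹ ≤ 2 * N := by
  have hN : (0 : ℝ) < N := by exact_mod_cast (Nat.zero_le k).trans_lt hk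
  set x := (l : ℝ) / N - (k : ℝ) / N with hx
  have hx' : x * N = l - k := by rw [hx]; field_simp
  have h1 : 1 ≤ |x| * N := by
    rw [← abs_of_pos hN, ← abs_mul, hx']
    have : (1 : ℤ) ≤ |(l : ℤ) - k| := Int.one_le_abs (by omega)
    exact_mod_cast this
  have h2 : |x| ≤ 1 := by
    refine le_of_mul_le_mul_right ?_ hN
    rw [← abs_of_pos hN, ← abs_mul, abs_of_pos hN, hx', one_mul, abs_le]
    have : (l : ℝ) < N := by exact_mod_cast hl
    have : (k : ℝ) < N := by exact_mod_cast hk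
    have : (0 : ℝ) ≤ l := by positivity
    have : (0 : ℝ) ≤ k := by positivity
    constructor <;> linarith
  have h3 : 2 / Real.pi * |x| ≤ |Real.sin x| := by
    refine Real.mul_abs_le_abs_sin (h2.trans ?_)
    linarith [Real.pi_gt_three]
  have h4 : (1 : ℝ) / 2 ≤ 2 / Real.pi := by
    rw [div_le_div_iff₀ two_pos Real.pi_pos]
    linarith [Real.pi_le_four]
  have h5 : |x| / 2 ≤ |Real.sin x| := by
    refine le_trans ?_ h3
    nlinarith [abs_nonneg x]
  have h6 : (2 * (N : ℝ))⁻¹ ≤ |Real.sin x| := by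
    refine le_trans ?_ h5
    rw [inv_le_iff_one_le_mul₀ (by positivity)]
    linarith
  have h7 : 0 < |Real.sin x| := lt_of_lt_of_le (by positivity) h6
  exact ⟨abs_pos.1 h7, inv_le_of_inv_le₀ (by positivity) h6⟩

/-- In the average over the `N` angles `k / N`, the `N` diagonal terms produce the factor `1 / N`,
and the others are bounded using the smaller of the two sets. The number `N` stays free, to be
balanced against the ratio of the measures. -/
theorem sq_enorm_radialProj_le (hE : MeasurableSet E) (hE' : MeasurableSet E')
    (hF : ∀ᵐ z, ‖F z‖ₑ ≤ A * (E.indicator 1 z.1 * E'.indicator 1 z.2)) {N : ℕ} (hN : N ≠ 0) :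
    ‖radialProj d F‖ₑ ^ 2 ≤ A ^ 2 * (volume E * volume E' / N +
      (2 * N) ^ d * min (volume E) (volume E') ^ 2) := by
  have hN0 : (N : ℝ≥0∞) ≠ 0 := by exact_mod_cast hN
  have hNt : (N : ℝ≥0∞) ≠ ⊤ := ENNReal.natCast_ne_top N
  set a := A ^ 2 * (volume E * volume E') with ha
  set b := A ^ 2 * ((2 * N) ^ d * min (volume E) (volume E') ^ 2) with hb
  have key : ∀ k ∈ Finset.range N, ∀ l ∈ Finset.range N,
      ‖inner ℂ F (rotL2 d ((l : ℝ) / N - (k : ℝ) / N) F)‖ₑ ≤ (if l = k then a else 0) + b := by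
    intro k hk l hl
    split_ifs with hkl
    · rw [hkl, sub_self, rotL2_zero]
      exact (sq_enorm_le_of_le_indicator hE hE' hF).trans le_self_add
    · rw [zero_add]
      obtain ⟨h1, h2⟩ := abs_sin_inv_le (Finset.mem_range.1 hk) (Finset.mem_range.1 hl)
        (Ne.symm hkl)
      have h3 : ENNReal.ofReal (|Real.sin ((l : ℝ) / N - (k : ℝ) / N)|⁻¹ ^ d) ≤ (2 * N) ^ d := by
        rw [ENNReal.ofReal_pow (by positivity)]
        gcongr
        refine (ENNReal.ofReal_le_ofReal h2).trans_eq ?_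
        rw [ENNReal.ofReal_mul two_pos.le]
        simp
      rcases le_total (volume E) (volume E') with h | h
      · refine (enorm_inner_rotL2_le_left hE hF h1).trans ?_
        rw [hb, min_eq_left h]
        gcongr
      · refine (enorm_inner_rotL2_le_right hE' hF h1).trans ?_
        rw [hb, min_eq_right h]
        gcongr
  have h := (sq_enorm_radialProj_le_sum F N fun k => (k : ℝ) / N).trans
    (Finset.sum_le_sum fun k hk => Finset.sum_le_sum fun l hl => key k hk l hl)
  have h' : ∑ k ∈ Finset.range N, ∑ l ∈ Finset.range N, ((if l = k then a else 0) + b) =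
      (N : ℝ≥0∞) ^ 2 * (a / N + b) := by
    have : ∀ k ∈ Finset.range N, ∑ l ∈ Finset.range N, ((if l = k then a else 0) + b) =
        a + N * b := by
      intro k hk
      rw [Finset.sum_add_distrib, Finset.sum_ite_eq', if_pos hk]
      simp
    rw [Finset.sum_congr rfl this]
    simp only [Finset.sum_const, Finset.card_range, nsmul_eq_mul]
    rw [mul_add, mul_add, sq, mul_assoc, ENNReal.mul_div_cancel hN0 hNt]
    ring
  rw [h', ENNReal.mul_le_mul_iff_right (pow_ne_zero _ hN0) (ENNReal.pow_ne_top hNt)] at h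
  refine h.trans_eq ?_
  rw [ha, hb, mul_div_assoc, mul_add]

end

/-! ### The projection is a contraction in the uniform norm -/

theorem sq_enorm_eq_lintegral {α : Type*} [MeasurableSpace α] {μ : Measure α} (F : Lp ℂ 2 μ) :
    ‖F‖ₑ ^ 2 = ∫⁻ z, ‖F z‖ₑ ^ 2 ∂μ := by
  have h := eLpNorm_nnreal_pow_eq_lintegral (f := (F : α → ℂ)) (μ := μ) (p := 2) two_ne_zero
  simp only [NNReal.coe_ofNat, ENNReal.coe_ofNat, ENNReal.rpow_ofNat] at h
  rw [Lp.enorm_def, h]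

theorem enorm_inner_self {H : Type*} [NormedAddCommGroup H] [InnerProductSpace ℂ H] (x : H) :
    ‖inner ℂ x x‖ₑ = ‖x‖ₑ ^ 2 := by
  rw [inner_self_eq_norm_sq_to_K, enorm_pow]
  simp [enorm_eq_nnnorm]

/-- Test against `W`, the part of the projection `H` where it exceeds `M`. As `W` is radial, `‖W‖² =
⟨H, W⟩ = ⟨G, W⟩ ≤ M ∫ |W|`. But `M |W| ≤ |W|²` pointwise, strictly where `W ≠ 0`, so `W` vanishes.
-/
theorem ae_enorm_radialProj_le {d : ℕ} {G : L2Prod d} {M : ℝ≥0∞} (hG : ∀ᵐ z, ‖G z‖ₑ ≤ M) :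
    ∀ᵐ z, ‖radialProj d G z‖ₑ ≤ M := by
  obtain ⟨h, hm, hH⟩ := radialProj_mem G
  set H := radialProj d G with hHdef
  set k : ℝ → ℂ := {r | M < ‖h r‖ₑ}.indicator h with hk
  have hB : MeasurableSet {r | M < ‖h r‖ₑ} := measurableSet_lt measurable_const hm.enorm
  have hkm : Measurable k := hm.indicator hB
  have hWmem : MemLp (fun z : Rd d × Rd d => k (radius z)) 2 volume := by
    refine (Lp.memLp H).mono (hkm.comp measurable_radius).aestronglyMeasurable ?_
    filter_upwards [hH] with z hz
    rw [hz]
    exact norm_indicator_le_norm_self _ _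
  set W : L2Prod d := hWmem.toLp _ with hW
  have hWz : ∀ᵐ z, W z = k (radius z) := hWmem.coeFn_toLp
  have hWrad : W ∈ radialSubspace d := ⟨k, hkm, hWz⟩
  have h1 : inner ℂ G W = inner ℂ H W := by
    have := Submodule.starProjection_inner_eq_zero (K := radialSubspace d) G W hWrad
    rwa [inner_sub_left, sub_eq_zero] at this
  have h2 : inner ℂ H W = inner ℂ W W := by
    rw [L2.inner_def, L2.inner_def]
    refine integral_congr_ae ?_
    filter_upwards [hH, hWz] with z h3 h4
    rw [h3, h4, hk]
    by_cases hz : radius z ∈ {r | M < ‖h r‖ₑ}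
    · rw [Set.indicator_of_mem hz]
    · rw [Set.indicator_of_notMem hz, inner_zero_right, inner_zero_right]
  have h3 : ∫⁻ z, ‖W z‖ₑ ^ 2 ≤ ∫⁻ z, M * ‖W z‖ₑ := by
    rw [← sq_enorm_eq_lintegral, ← enorm_inner_self, ← h2, ← h1]
    refine (enorm_inner_le_lintegral _ _).trans (lintegral_mono_ae ?_)
    filter_upwards [hG] with z hz
    gcongr
  have h4 : ∀ᵐ z, M * ‖W z‖ₑ ≤ ‖W z‖ₑ ^ 2 := by
    filter_upwards [hWz] with z hz
    rw [hz, hk, sq]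
    by_cases hz' : radius z ∈ {r | M < ‖h r‖ₑ}
    · rw [Set.indicator_of_mem hz']
      gcongr
      exact le_of_lt hz'
    · simp [Set.indicator_of_notMem hz']
  have hfin : ∫⁻ z, ‖W z‖ₑ ^ 2 ≠ ⊤ := by
    rw [← sq_enorm_eq_lintegral]
    exact ENNReal.pow_ne_top enorm_ne_top
  -- Pointwise and integral inequalities in opposite directions force equality, the integrals being
  -- finite.
  have h5 : (fun z => M * ‖W z‖ₑ) =ᵐ[volume] fun z => ‖W z‖ₑ ^ 2 :=
    ae_eq_of_ae_le_of_lintegral_le h4 (ne_top_of_le_ne_top hfin (lintegral_mono_ae h4))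
      ((Lp.aestronglyMeasurable W).enorm.pow_const 2) h3
  filter_upwards [h5, hWz, hH] with z h6 h7 h8
  rw [h8]
  by_contra! hz
  have hz' : radius z ∈ {r | M < ‖h r‖ₑ} := hz
  simp only [h7, hk, Set.indicator_of_mem hz', sq] at h6
  exact hz.ne ((ENNReal.mul_left_inj (pos_of_gt hz).ne' enorm_ne_top).1 h6)

theorem enorm_inner_radialProj_le {d : ℕ} {F G : L2Prod d} {M : ℝ≥0∞}
    (hG : ∀ᵐ z, ‖G z‖ₑ ≤ M) :
    ‖inner ℂ (radialProj d F) (radialProj d G)‖ₑ ≤ (∫⁻ z, ‖F z‖ₑ) * M := by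
  have h1 : inner ℂ (radialProj d F) (radialProj d G) = inner ℂ F (radialProj d G) := by
    have := Submodule.starProjection_inner_eq_zero (K := radialSubspace d) F _ (radialProj_mem G)
    rw [inner_sub_left, sub_eq_zero] at this
    exact this.symm
  rw [h1, ← lintegral_mul_const'' _ (Lp.aestronglyMeasurable F).enorm]
  refine (enorm_inner_le_lintegral _ _).trans (lintegral_mono_ae ?_)
  filter_upwards [ae_enorm_radialProj_le hG] with z hz
  gcongr

/-! ### The tensor product as a continuous bilinear map -/

theorem ae_fst {d : ℕ} {p : Rd d → Prop} (h : ∀ᵐ x, p x) : ∀ᵐ z : Rd d × Rd d, p z.1 :=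
  Measure.quasiMeasurePreserving_fst.ae h

theorem ae_snd {d : ℕ} {p : Rd d → Prop} (h : ∀ᵐ x, p x) : ∀ᵐ z : Rd d × Rd d, p z.2 :=
  Measure.quasiMeasurePreserving_snd.ae h

theorem coeFn_tensor {d : ℕ} (f g : L2 d) : ∀ᵐ z, tensor f g z = f z.1 * g z.2 :=
  (memLp_tensor f g).coeFn_toLp

theorem enorm_tensor {d : ℕ} (f g : L2 d) : ‖tensor f g‖ₑ = ‖f‖ₑ * ‖g‖ₑ := by
  refine (ENNReal.pow_right_strictMono two_ne_zero).injective ?_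
  rw [mul_pow, sq_enorm_eq_lintegral, sq_enorm_eq_lintegral, sq_enorm_eq_lintegral,
    ← lintegral_prod_mul ((Lp.aestronglyMeasurable f).enorm.pow_const 2)
      ((Lp.aestronglyMeasurable g).enorm.pow_const 2), ← Measure.volume_eq_prod]
  refine lintegral_congr_ae ?_
  filter_upwards [coeFn_tensor f g] with z hz
  rw [hz, enorm_mul, mul_pow]

/-- The tensor product as a continuous bilinear map. -/
noncomputable def tensorCLM (d : ℕ) : L2 d →L[ℂ] L2 d →L[ℂ] L2Prod d :=
  LinearMap.mkContinuous₂
    (LinearMap.mk₂ ℂ tensor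
      (fun f f' g => by
        apply Lp.ext
        filter_upwards [coeFn_tensor (f + f') g, coeFn_tensor f g, coeFn_tensor f' g,
          Lp.coeFn_add (tensor f g) (tensor f' g), ae_fst (Lp.coeFn_add f f')] with z h1 h2 h3 h4 h5
        rw [h1, h4, Pi.add_apply, h2, h3, h5, Pi.add_apply, add_mul])
      (fun c f g => by
        apply Lp.ext
        filter_upwards [coeFn_tensor (c • f) g, coeFn_tensor f g,
          Lp.coeFn_smul c (tensor f g), ae_fst (Lp.coeFn_smul c f)] with z h1 h2 h3 h4
        rw [h1, h3, Pi.smul_apply, h2, h4, Pi.smul_apply, smul_eq_mul, smul_eq_mul, mul_assoc])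
      (fun f g g' => by
        apply Lp.ext
        filter_upwards [coeFn_tensor f (g + g'), coeFn_tensor f g, coeFn_tensor f g',
          Lp.coeFn_add (tensor f g) (tensor f g'), ae_snd (Lp.coeFn_add g g')] with z h1 h2 h3 h4 h5
        rw [h1, h4, Pi.add_apply, h2, h3, h5, Pi.add_apply, mul_add])
      (fun c f g => by
        apply Lp.ext
        filter_upwards [coeFn_tensor f (c • g), coeFn_tensor f g,
          Lp.coeFn_smul c (tensor f g), ae_snd (Lp.coeFn_smul c g)] with z h1 h2 h3 h4
        rw [h1, h3, Pi.smul_apply, h2, h4, Pi.smul_apply, smul_eq_mul, smul_eq_mul,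
          mul_left_comm]))
    1 fun f g => by
      have h := congrArg ENNReal.toReal (enorm_tensor f g)
      simp only [toReal_enorm, ENNReal.toReal_mul] at h
      rw [one_mul, ← h, LinearMap.mk₂_apply]

theorem tensorCLM_apply {d : ℕ} (f g : L2 d) : tensorCLM d f g = tensor f g := rfl

/-! ### Dyadic decomposition along the decreasing rearrangement -/

section Rearrangement

variable {α : Type*} [MeasurableSpace α] {μ : Measure α} {f : α → ℂ}

theorem decreasingRearrangement_antitone : Antitone (decreasingRearrangement μ f) :=
  fun _ _ hst => sInf_le_sInf fun _ hs => le_trans hs (ENNReal.ofReal_le_ofReal hst)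

/-- The infimum is attained: along a sequence decreasing to it the superlevel sets increase, and the
measure is continuous from below. -/
theorem measure_decreasingRearrangement_lt_le (t : ℝ) :
    μ {x | decreasingRearrangement μ f t < ‖f x‖ₑ} ≤ ENNReal.ofReal t := by
  obtain ⟨u, hu, hlim, hmem⟩ := exists_seq_tendsto_sInf
    (S := {s : ℝ≥0∞ | μ {x | s < ‖f x‖ₑ} ≤ ENNReal.ofReal t})
    ⟨⊤, by simp⟩ (OrderBot.bddBelow _)
  have h : {x | decreasingRearrangement μ f t < ‖f x‖ₑ} = ⋃ n, {x | u n < ‖f x‖ₑ} := by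
    ext x
    simp only [Set.mem_ofPred_eq, Set.mem_iUnion]
    constructor
    · intro hx
      exact (hlim.eventually_lt_const hx).exists
    · rintro ⟨n, hn⟩
      exact lt_of_le_of_lt (sInf_le (hmem n)) hn
  have hmono : Monotone fun n => {x | u n < ‖f x‖ₑ} :=
    fun m n hmn x hx => lt_of_le_of_lt (hu hmn) hx
  rw [h, hmono.measure_iUnion]
  exact iSup_le hmem

end Rearrangement

variable {d : ℕ}

/-- The value of the decreasing rearrangement at `4 ^ j`. -/
noncomputable def level (f : L2 d) (j : ℤ) : ℝ≥0∞ :=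
  decreasingRearrangement volume f ((4 : ℝ) ^ j)

/-- The set where `|f|` lies between the consecutive levels `j + 1` and `j`. -/
def levelSet (f : L2 d) (j : ℤ) : Set (Rd d) :=
  {x | level f (j + 1) < ‖f x‖ₑ ∧ ‖f x‖ₑ ≤ level f j}

theorem level_antitone (f : L2 d) : Antitone (level f) := fun _ _ hij =>
  decreasingRearrangement_antitone (zpow_le_zpow_right₀ (by norm_num) hij)

theorem measurableSet_levelSet (f : L2 d) (j : ℤ) : MeasurableSet (levelSet f j) :=
  (measurableSet_lt measurable_const (Lp.stronglyMeasurable f).measurable.enorm).inter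
    (measurableSet_le (Lp.stronglyMeasurable f).measurable.enorm measurable_const)

theorem ofReal_four_zpow (j : ℤ) : ENNReal.ofReal ((4 : ℝ) ^ j) = 4 ^ j := by
  cases j with
  | ofNat n =>
    rw [Int.ofNat_eq_natCast, zpow_natCast, zpow_natCast, ENNReal.ofReal_pow (by norm_num)]
    simp
  | negSucc n =>
    rw [zpow_negSucc, zpow_negSucc, ENNReal.ofReal_inv_of_pos (by positivity),
      ENNReal.ofReal_pow (by norm_num)]
    simp

theorem volume_level_lt_le (f : L2 d) (j : ℤ) : volume {x | level f j < ‖f x‖ₑ} ≤ 4 ^ j :=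
  (measure_decreasingRearrangement_lt_le _).trans_eq (ofReal_four_zpow j)

theorem volume_levelSet_le (f : L2 d) (j : ℤ) : volume (levelSet f j) ≤ 4 ^ (j + 1) :=
  (measure_mono fun _ hx => hx.1).trans (volume_level_lt_le f (j + 1))

/-- The part of `f` living on a level set. -/
noncomputable def piece (f : L2 d) (j : ℤ) : L2 d :=
  ((Lp.memLp f).indicator (measurableSet_levelSet f j)).toLp _

theorem coeFn_piece (f : L2 d) (j : ℤ) :
    piece f j =ᵐ[volume] (levelSet f j).indicator f :=
  ((Lp.memLp f).indicator (measurableSet_levelSet f j)).coeFn_toLp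

theorem enorm_piece_le (f : L2 d) (j : ℤ) :
    ∀ᵐ x, ‖piece f j x‖ₑ ≤ level f j * (levelSet f j).indicator 1 x := by
  filter_upwards [coeFn_piece f j] with x hx
  rw [hx]
  by_cases h : x ∈ levelSet f j
  · simpa [Set.indicator_of_mem h] using h.2
  · simp [Set.indicator_of_notMem h]

theorem eq_of_mem_levelSet {f : L2 d} {i j : ℤ} {x : Rd d} (hi : x ∈ levelSet f i)
    (hj : x ∈ levelSet f j) : i = j := by
  by_contra hne
  rcases lt_or_gt_of_ne hne with h | h
  · exact absurd (hj.2.trans (level_antitone f h)) (not_le.2 hi.1)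
  · exact absurd (hi.2.trans (level_antitone f h)) (not_le.2 hj.1)

theorem volume_lt_enorm_lt_top (f : L2 d) {s : ℝ≥0∞} (hs : s ≠ 0) :
    volume {x | s < ‖f x‖ₑ} < ⊤ := by
  rcases eq_or_ne s ⊤ with rfl | hst
  · simp
  have h := meas_ge_le_lintegral_div (μ := volume)
    ((Lp.aestronglyMeasurable f).enorm.pow_const 2) (ε := s ^ 2) (pow_ne_zero 2 hs)
    (ENNReal.pow_ne_top hst)
  rw [← sq_enorm_eq_lintegral] at h
  refine lt_of_le_of_lt (measure_mono fun x hx => ?_) (lt_of_le_of_lt h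
    (ENNReal.div_lt_top (ENNReal.pow_ne_top enorm_ne_top) (pow_ne_zero 2 hs)))
  exact pow_le_pow_left' (le_of_lt (show s < ‖f x‖ₑ from hx)) 2

theorem tendsto_four_zpow_atTop : Tendsto (fun n : ℕ => (4 : ℝ≥0∞) ^ (n : ℤ)) atTop (𝓝 ⊤) := by
  simp only [zpow_natCast]
  exact ENNReal.tendsto_pow_atTop_nhds_top_iff.2 (by norm_num)

/-- The levels tend to zero, since an L² function has superlevel sets of finite measure at every
positive height. -/
theorem exists_level_lt (f : L2 d) {x : Rd d} (hx : f x ≠ 0) : ∃ n : ℕ, level f n < ‖f x‖ₑ := by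
  obtain ⟨s, hs0, hs⟩ := exists_between (pos_iff_ne_zero.2 (enorm_ne_zero.2 hx))
  obtain ⟨n, hn⟩ := (tendsto_four_zpow_atTop.eventually_const_lt
    (volume_lt_enorm_lt_top f hs0.ne')).exists
  refine ⟨n, lt_of_le_of_lt (sInf_le ?_) hs⟩
  rw [Set.mem_ofPred_eq, ofReal_four_zpow]
  exact hn.le

theorem ae_exists_le_level (f : L2 d) : ∀ᵐ x, ∃ n : ℕ, ‖f x‖ₑ ≤ level f (-n) := by
  rw [ae_iff]
  refine le_antisymm (ge_of_tendsto' (x := atTop) (f := fun n : ℕ => (4 : ℝ≥0∞) ^ (-(n : ℤ))) ?_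
    fun n => (measure_mono fun x hx => ?_).trans (volume_level_lt_le f (-n))) zero_le
  · simp only [ENNReal.zpow_neg]
    have := tendsto_inv_iff.2 tendsto_four_zpow_atTop
    simpa using this
  · simp only [not_exists, not_le, Set.mem_ofPred_eq] at hx
    exact hx n

theorem ae_exists_mem_levelSet (f : L2 d) : ∀ᵐ x, f x ≠ 0 → ∃ j, x ∈ levelSet f j := by
  filter_upwards [ae_exists_le_level f] with x ⟨m, hm⟩ hx
  obtain ⟨n, hn⟩ := exists_level_lt f hx
  -- The index sought is the last one whose level still dominates `|f x|`.
  obtain ⟨j, hj, hmax⟩ := Int.exists_greatest_of_bdd (P := fun j => ‖f x‖ₑ ≤ level f j)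
    ⟨n, fun z hz => by
      by_contra! h
      exact absurd (hz.trans (level_antitone f h.le)) (not_le.2 hn)⟩ ⟨_, hm⟩
  exact ⟨j, not_le.1 fun h => by have := hmax _ h; omega, hj⟩

theorem coeFn_sum_piece (f : L2 d) (s : Finset ℤ) :
    ∀ᵐ x, (∑ j ∈ s, piece f j : L2 d) x = ∑ j ∈ s, (levelSet f j).indicator f x := by
  filter_upwards [Lp.coeFn_finsetSum s (piece f), (ae_ball_iff s.countable_toSet).2
    fun j _ => coeFn_piece f j] with x h1 h2
  rw [h1, Finset.sum_apply]
  exact Finset.sum_congr rfl h2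

theorem sum_indicator_levelSet (f : L2 d) (s : Finset ℤ) {x : Rd d} {j : ℤ}
    (hx : x ∈ levelSet f j) :
    ∑ i ∈ s, (levelSet f i).indicator f x = if j ∈ s then f x else 0 := by
  rw [← Finset.sum_ite_eq s j fun _ => f x]
  refine Finset.sum_congr rfl fun i _ => ?_
  split_ifs with h
  · rw [← h, Set.indicator_of_mem hx]
  · exact Set.indicator_of_notMem (fun hi => h (eq_of_mem_levelSet hx hi)) _

theorem sum_indicator_levelSet_of_eq_zero (f : L2 d) (s : Finset ℤ) {x : Rd d} (hx : f x = 0) :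
    ∑ i ∈ s, (levelSet f i).indicator f x = 0 :=
  Finset.sum_eq_zero fun i _ => by simp [hx]

/-- At almost every point a partial sum is either `f x` or `0`, and finally `f x`; dominated
convergence applies with majorant `|f|²`. -/
theorem tendsto_sum_piece (f : L2 d) :
    Tendsto (fun n : ℕ => ∑ j ∈ Finset.Ico (-(n : ℤ)) n, piece f j) atTop (𝓝 f) := by
  rw [tendsto_iff_edist_tendsto_0]
  have key : Tendsto (fun n : ℕ => ∫⁻ x, ‖f x - ∑ j ∈ Finset.Ico (-(n : ℤ)) n,
      (levelSet f j).indicator f x‖ₑ ^ 2) atTop (𝓝 (∫⁻ _ : Rd d, 0)) := by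
    refine tendsto_lintegral_of_dominated_convergence (fun x => ‖f x‖ₑ ^ 2) (fun n => ?_)
      (fun n => ?_) ?_ ?_
    · have hf : Measurable f := (Lp.stronglyMeasurable f).measurable
      exact (hf.sub (Finset.measurable_fun_sum _ fun j _ =>
        hf.indicator (measurableSet_levelSet f j))).enorm.pow_const 2
    · filter_upwards [ae_exists_mem_levelSet f] with x hx
      by_cases h0 : f x = 0
      · rw [sum_indicator_levelSet_of_eq_zero f _ h0, sub_zero]
      · obtain ⟨j, hj⟩ := hx h0
        rw [sum_indicator_levelSet f _ hj]
        split_ifs <;> simp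
    · rw [← sq_enorm_eq_lintegral]
      exact ENNReal.pow_ne_top enorm_ne_top
    · filter_upwards [ae_exists_mem_levelSet f] with x hx
      refine tendsto_const_nhds.congr' ?_
      by_cases h0 : f x = 0
      · refine Eventually.of_forall fun n => ?_
        simp only [sum_indicator_levelSet_of_eq_zero f _ h0]
        simp [h0]
      · obtain ⟨j, hj⟩ := hx h0
        filter_upwards [eventually_gt_atTop j.natAbs] with n hn
        rw [sum_indicator_levelSet f _ hj, if_pos (Finset.mem_Ico.2 (by omega))]
        simp
  have h2 : Tendsto (fun n : ℕ => ‖f - ∑ j ∈ Finset.Ico (-(n : ℤ)) n, piece f j‖ₑ ^ 2)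
      atTop (𝓝 0) := by
    rw [lintegral_zero] at key
    refine key.congr fun n => ?_
    rw [sq_enorm_eq_lintegral]
    refine lintegral_congr_ae ?_
    filter_upwards [coeFn_sum_piece f (Finset.Ico (-(n : ℤ)) n),
      Lp.coeFn_sub f (∑ j ∈ Finset.Ico (-(n : ℤ)) n, piece f j)] with x h1 h2
    rw [h2, Pi.sub_apply, h1]
  have h3 := (ENNReal.continuous_rpow_const (y := 1 / 2)).tendsto _ |>.comp h2
  rw [ENNReal.zero_rpow_of_pos (by norm_num)] at h3
  refine h3.congr fun n => ?_
  rw [Function.comp_apply, ← ENNReal.rpow_natCast, ← ENNReal.rpow_mul, edist_comm,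
    edist_eq_enorm_sub]
  norm_num

/-! ### Almost orthogonality of the pieces -/

/-- The contribution of the level `j` to the Lorentz norm. -/
noncomputable def weight {d : ℕ} (f : L2 d) (j : ℤ) : ℝ≥0∞ := 2 ^ j * level f j

theorem enorm_tensor_piece_le {d : ℕ} (f g : L2 d) (j k : ℤ) :
    ∀ᵐ z, ‖tensor (piece f j) (piece g k) z‖ₑ ≤ (level f j * level g k) *
      ((levelSet f j).indicator 1 z.1 * (levelSet g k).indicator 1 z.2) := by
  filter_upwards [coeFn_tensor (piece f j) (piece g k), ae_fst (enorm_piece_le f j),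
    ae_snd (enorm_piece_le g k)] with z h1 h2 h3
  rw [h1, enorm_mul, mul_mul_mul_comm]
  gcongr

theorem four_zpow_eq (j : ℤ) : (4 : ℝ≥0∞) ^ j = (2 ^ j) ^ 2 := by
  have h : ∀ n : ℕ, (4 : ℝ≥0∞) ^ n = (2 ^ n) ^ 2 := fun n => by
    rw [← pow_mul, mul_comm, pow_mul]; norm_num
  cases j with
  | ofNat n => rw [Int.ofNat_eq_natCast, zpow_natCast, zpow_natCast, h]
  | negSucc n => rw [zpow_negSucc, zpow_negSucc, ENNReal.inv_pow.symm, h]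

theorem four_zpow_add_one (j : ℤ) : (4 : ℝ≥0∞) ^ (j + 1) = 4 * 4 ^ j := by
  rw [ENNReal.zpow_add (by simp) (by simp), zpow_one, mul_comm]

theorem min_four_zpow_sq_mul (j k : ℤ) :
    min ((4 : ℝ≥0∞) ^ (j + 1)) (4 ^ (k + 1)) ^ 2 * 4 ^ (j - k).natAbs = 16 * (4 ^ j * 4 ^ k) := by
  wlog h : j ≤ k generalizing j k
  · rw [min_comm, mul_comm (4 ^ j), ← this k j (le_of_not_ge h)]
    congr 2
    omega
  have hmono : (4 : ℝ≥0∞) ^ (j + 1) ≤ 4 ^ (k + 1) :=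
    ENNReal.zpow_le_of_le (by norm_num) (by omega)
  have hk : (4 : ℝ≥0∞) ^ k = 4 ^ j * 4 ^ (j - k).natAbs := by
    rw [← zpow_natCast, ← ENNReal.zpow_add (by simp) (by simp)]
    congr 1
    omega
  rw [min_eq_left hmono, hk, four_zpow_add_one]
  ring

/-- Averaging over `N = 4 ^ m` angles makes the diagonal gain `4 ^ (-m)`. The off-diagonal part
loses `4 ^ (m * d)` but gains `4 ^ (-|j - k|)` from the smaller support, and `hm` makes the net gain
at least `4 ^ (-m)` too. The square root halves the exponent. -/
theorem enorm_radialProj_tensor_piece_le {d : ℕ} (f g : L2 d) (j k : ℤ) {m : ℕ}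
    (hm : m * (d + 1) ≤ (j - k).natAbs) :
    ‖radialProj d (tensor (piece f j) (piece g k))‖ₑ * 2 ^ m ≤
      2 ^ (d + 3) * (weight f j * weight g k) := by
  set n := (j - k).natAbs
  set X := ‖radialProj d (tensor (piece f j) (piece g k))‖ₑ
  have h := sq_enorm_radialProj_le (measurableSet_levelSet f j) (measurableSet_levelSet g k)
    (enorm_tensor_piece_le f g j k) (N := 4 ^ m) (by positivity)
  have hcast : ((4 ^ m : ℕ) : ℝ≥0∞) = 4 ^ m := by push_cast; rfl
  rw [hcast] at h
  set A := level f j * level g k with hA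
  have h4m0 : (4 : ℝ≥0∞) ^ m ≠ 0 := by positivity
  have h4mt : (4 : ℝ≥0∞) ^ m ≠ ⊤ := ENNReal.pow_ne_top (by simp)
  have e1 : volume (levelSet f j) * volume (levelSet g k) / 4 ^ m * 4 ^ m ≤
      16 * (4 ^ j * 4 ^ k) := by
    rw [ENNReal.div_mul_cancel h4m0 h4mt]
    refine (mul_le_mul' (volume_levelSet_le f j) (volume_levelSet_le g k)).trans_eq ?_
    rw [four_zpow_add_one, four_zpow_add_one]
    ring
  have e2 : (2 * 4 ^ m : ℝ≥0∞) ^ d * min (volume (levelSet f j)) (volume (levelSet g k)) ^ 2 *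
      4 ^ m ≤ 2 ^ d * (16 * (4 ^ j * 4 ^ k)) := by
    rw [← min_four_zpow_sq_mul]
    calc (2 * 4 ^ m : ℝ≥0∞) ^ d * min (volume (levelSet f j)) (volume (levelSet g k)) ^ 2 * 4 ^ m
        = 2 ^ d * (min (volume (levelSet f j)) (volume (levelSet g k)) ^ 2 *
            4 ^ (m * (d + 1))) := by
          rw [mul_pow, ← pow_mul, mul_add, pow_add]; ring
      _ ≤ _ := by
          gcongr
          · exact volume_levelSet_le f j
          · exact volume_levelSet_le g k
          · norm_num
  have h16 : (1 + 2 ^ d : ℝ≥0∞) * 16 ≤ (2 ^ (d + 3)) ^ 2 := by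
    have h1 : (1 : ℝ≥0∞) ≤ 2 ^ d := one_le_pow₀ (by norm_num)
    calc (1 + 2 ^ d : ℝ≥0∞) * 16 ≤ (2 ^ d * 2 ^ d + 2 ^ d * 2 ^ d) * 16 := by
          gcongr
          · exact one_le_mul h1 h1
          · exact le_mul_of_one_le_left' h1
      _ ≤ (2 ^ d * 2 ^ d + 2 ^ d * 2 ^ d) * 32 := by gcongr; norm_num
      _ = (2 ^ (d + 3)) ^ 2 := by ring
  refine (ENNReal.pow_le_pow_left_iff (n := 2) two_ne_zero).1 ?_
  calc (X * 2 ^ m) ^ 2 = X ^ 2 * 4 ^ m := by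
        rw [mul_pow, ← pow_mul, mul_comm m, pow_mul]; norm_num
    _ ≤ A ^ 2 * (16 * (4 ^ j * 4 ^ k) + 2 ^ d * (16 * (4 ^ j * 4 ^ k))) := by
        refine (mul_le_mul_left h _).trans ?_
        rw [mul_assoc, add_mul]
        gcongr
    _ = (1 + 2 ^ d) * 16 * (A ^ 2 * (4 ^ j * 4 ^ k)) := by ring
    _ ≤ (2 ^ (d + 3)) ^ 2 * (A ^ 2 * (4 ^ j * 4 ^ k)) := by gcongr
    _ = _ := by
        rw [hA, weight, weight, four_zpow_eq, four_zpow_eq]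
        ring

/-- The L¹ norm is taken on the tensor with the smaller index sum, hence the smaller support bound,
and the uniform norm on the other. The factor 16 comes from the supports having measure at most `4 ^
(j + 1)` and `4 ^ (k + 1)`. -/
theorem enorm_inner_radialProj_tensor_piece_le {d : ℕ} (f g : L2 d) (j k l m : ℤ) :
    ‖inner ℂ (radialProj d (tensor (piece f j) (piece g k)))
      (radialProj d (tensor (piece f l) (piece g m)))‖ₑ * 2 ^ (j + k - l - m).natAbs ≤
      16 * (weight f j * weight g k * (weight f l * weight g m)) := by
  wlog h : j + k ≤ l + m generalizing j k l m
  · have h1 := this l m j k (by omega)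
    have h2 : (l + m - j - k).natAbs = (j + k - l - m).natAbs := by omega
    rw [h2] at h1
    rw [← ofReal_norm, norm_inner_symm, ofReal_norm]
    refine h1.trans_eq ?_
    rw [mul_comm (weight f l * weight g m)]
  have hG : ∀ᵐ z, ‖tensor (piece f l) (piece g m) z‖ₑ ≤ level f l * level g m := by
    filter_upwards [enorm_tensor_piece_le f g l m] with z hz
    exact hz.trans (mul_le_of_le_one_right' ((indicator_one_mul_le_left _ _).trans
      (Set.indicator_le_self' (by simp) _)))
  have h1 := enorm_inner_radialProj_le (F := tensor (piece f j) (piece g k)) hG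
  have h2 := lintegral_enorm_le_of_le_indicator (measurableSet_levelSet f j)
    (measurableSet_levelSet g k) (enorm_tensor_piece_le f g j k)
  have h3 : (2 : ℝ≥0∞) ^ l * 2 ^ m = 2 ^ j * 2 ^ k * 2 ^ (j + k - l - m).natAbs := by
    rw [← zpow_natCast, ← ENNReal.zpow_add (by simp) (by simp),
      ← ENNReal.zpow_add (by simp) (by simp), ← ENNReal.zpow_add (by simp) (by simp)]
    congr 1
    omega
  calc _ ≤ level f j * level g k * (4 ^ (j + 1) * 4 ^ (k + 1)) * (level f l * level g m) *
        2 ^ (j + k - l - m).natAbs := by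
        gcongr
        refine h1.trans ?_
        gcongr
        refine h2.trans ?_
        gcongr
        · exact volume_levelSet_le f j
        · exact volume_levelSet_le g k
    _ = 16 * (level f j * level g k * (level f l * level g m)) * (2 ^ j * 2 ^ k) *
        (2 ^ j * 2 ^ k * 2 ^ (j + k - l - m).natAbs) := by
        rw [four_zpow_add_one, four_zpow_add_one, four_zpow_eq, four_zpow_eq]
        ring
    _ = _ := by
        rw [← h3]
        simp only [weight]
        ring

theorem exists_pow_eq_half (d : ℕ) : ∃ κ : ℝ≥0, κ < 1 ∧ κ ^ (2 * (d + 1)) = 1 / 2 := by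
  have hn : (2 * (d + 1)) ≠ 0 := by positivity
  have h : ((1 / 2 : ℝ≥0) ^ ((2 * (d + 1) : ℕ) : ℝ)⁻¹) ^ (2 * (d + 1)) = 1 / 2 :=
    NNReal.rpow_inv_natCast_pow _ hn
  refine ⟨_, ?_, h⟩
  by_contra! h1
  have := one_le_pow₀ h1 (n := 2 * (d + 1))
  rw [h] at this
  have h2 : (1 : ℝ) ≤ 1 / 2 := by exact_mod_cast this
  norm_num at h2

/-- Since `2 (j - l) = (j + k - l - m) + (j - k) - (l - m)`, control of the three right-hand
differences controls `j - l`. If `|j + k - l - m|` is at most `|j - k| + |l - m|`, Cauchy–Schwarz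
with the decay of each factor suffices; otherwise the L¹–uniform bound does. -/
theorem enorm_inner_radialProj_tensor_piece_le_pow {d : ℕ} (f g : L2 d) {κ : ℝ≥0} (hκ : κ < 1)
    (hκ2 : κ ^ (2 * (d + 1)) = 1 / 2) (j k l m : ℤ) :
    ‖inner ℂ (radialProj d (tensor (piece f j) (piece g k)))
      (radialProj d (tensor (piece f l) (piece g m)))‖ₑ ≤
      2 ^ (2 * (d + 4)) * (weight f j * weight g k * (weight f l * weight g m)) *
        ((κ : ℝ≥0∞) ^ (j - k).natAbs * κ ^ (j - l).natAbs * κ ^ (l - m).natAbs) := by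
  have hκ1 : (κ : ℝ≥0∞) ≤ 1 := by exact_mod_cast hκ.le
  have hhalf : (κ : ℝ≥0∞) ^ (2 * (d + 1)) = 2⁻¹ := by
    rw [← ENNReal.coe_pow, hκ2]
    simp
  have hcancel : ∀ n : ℕ, (2 : ℝ≥0∞) ^ n * κ ^ (2 * (d + 1) * n) = 1 := by
    intro n
    rw [pow_mul, hhalf, ← mul_pow, ENNReal.mul_inv_cancel two_ne_zero (by simp), one_pow]
  have hP : ∀ j k : ℤ, ‖radialProj d (tensor (piece f j) (piece g k))‖ₑ ≤
      2 ^ (d + 4) * (weight f j * weight g k) * (κ : ℝ≥0∞) ^ (2 * (j - k).natAbs) := by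
    intro j k
    -- The largest admissible `m` is the integer part of `n / (d + 1)`; rounding costs at most one
    -- factor 2, whence `d + 4` in place of `d + 3`.
    set n := (j - k).natAbs
    have h1 : n / (d + 1) * (d + 1) ≤ n := Nat.div_mul_le_self _ _
    have h2 : n ≤ (d + 1) * (n / (d + 1)) + (d + 1) := by
      have := Nat.div_add_mod n (d + 1)
      have := Nat.mod_lt n (Nat.succ_pos d)
      linarith
    have h := enorm_radialProj_tensor_piece_le f g j k h1
    calc ‖radialProj d (tensor (piece f j) (piece g k))‖ₑ
        = ‖radialProj d (tensor (piece f j) (piece g k))‖ₑ * 2 ^ (n / (d + 1)) *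
          κ ^ (2 * (d + 1) * (n / (d + 1))) := by rw [mul_assoc, hcancel, mul_one]
      _ ≤ 2 ^ (d + 3) * (weight f j * weight g k) * κ ^ (2 * (d + 1) * (n / (d + 1))) := by gcongr
      _ = 2 ^ (d + 4) * (weight f j * weight g k) *
          (κ ^ (2 * (d + 1) * (n / (d + 1))) * κ ^ (2 * (d + 1))) := by
          rw [hhalf, pow_succ 2 (d + 3)]
          have : (2 : ℝ≥0∞) * 2⁻¹ = 1 := ENNReal.mul_inv_cancel two_ne_zero (by simp)
          calc _ = 2 ^ (d + 3) * (weight f j * weight g k) *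
                (κ : ℝ≥0∞) ^ (2 * (d + 1) * (n / (d + 1))) * (2 * 2⁻¹) := by rw [this, mul_one]
            _ = _ := by ring
      _ ≤ _ := by
          rw [← pow_add]
          refine mul_le_mul_right (pow_le_pow_right_of_le_one' hκ1 ?_) _
          nlinarith
  set X := ‖inner ℂ (radialProj d (tensor (piece f j) (piece g k)))
      (radialProj d (tensor (piece f l) (piece g m)))‖ₑ with hX
  rw [← pow_add, ← pow_add]
  rcases le_total (j + k - l - m).natAbs ((j - k).natAbs + (l - m).natAbs) with hle | hle
  · calc X ≤ ‖radialProj d (tensor (piece f j) (piece g k))‖ₑ *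
          ‖radialProj d (tensor (piece f l) (piece g m))‖ₑ := by
          rw [hX, ← ofReal_norm, ← ofReal_norm, ← ofReal_norm,
            ← ENNReal.ofReal_mul (norm_nonneg _)]
          exact ENNReal.ofReal_le_ofReal (norm_inner_le_norm _ _)
      _ ≤ _ := mul_le_mul' (hP j k) (hP l m)
      _ = 2 ^ (2 * (d + 4)) * (weight f j * weight g k * (weight f l * weight g m)) *
          (κ : ℝ≥0∞) ^ (2 * (j - k).natAbs + 2 * (l - m).natAbs) := by
          rw [pow_add (κ : ℝ≥0∞), mul_comm 2 (d + 4), pow_mul]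
          ring
      _ ≤ _ := by
          refine mul_le_mul_right (pow_le_pow_right_of_le_one' hκ1 ?_) _
          omega
  · set n := (j + k - l - m).natAbs with hn
    have h := enorm_inner_radialProj_tensor_piece_le f g j k l m
    have h16 : (16 : ℝ≥0∞) ≤ 2 ^ (2 * (d + 4)) := by
      calc (16 : ℝ≥0∞) = 2 ^ 4 := by norm_num
        _ ≤ _ := pow_le_pow_right' (by norm_num) (by omega)
    calc X = X * 2 ^ n * κ ^ (2 * (d + 1) * n) := by rw [mul_assoc, hcancel, mul_one]
      _ ≤ 2 ^ (2 * (d + 4)) * (weight f j * weight g k * (weight f l * weight g m)) *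
          κ ^ (2 * (d + 1) * n) := by
          exact mul_le_mul_left (h.trans (mul_le_mul_left h16 _)) _
      _ ≤ _ := by
          refine mul_le_mul_right (pow_le_pow_right_of_le_one' hκ1 ?_) _
          have : 2 * n ≤ 2 * (d + 1) * n := by nlinarith
          omega

/-! ### Summation -/

theorem tsum_int_pow_natAbs_ne_top {κ : ℝ≥0} (hκ : κ < 1) :
    ∑' p : ℤ, (κ : ℝ≥0∞) ^ p.natAbs ≠ ⊤ := by
  have h : Summable fun n : ℕ => (κ : ℝ) ^ n := summable_geometric_of_lt_one κ.2 hκ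
  have h2 : Summable fun p : ℤ => (κ : ℝ) ^ p.natAbs :=
    Summable.of_nat_of_neg (by simpa using h) (by simpa using h)
  have h3 : Summable fun p : ℤ => κ ^ p.natAbs := by
    rw [← NNReal.summable_coe]
    simpa only [NNReal.coe_pow] using h2
  have h4 := ENNReal.tsum_coe_ne_top_iff_summable.2 h3
  simpa only [ENNReal.coe_pow] using h4

theorem tsum_mul_le_sqrt_mul_sqrt {ι : Type*} (u v : ι → ℝ≥0∞) :
    ∑' i, u i * v i ≤ (∑' i, u i ^ 2) ^ (1 / 2 : ℝ) * (∑' i, v i ^ 2) ^ (1 / 2 : ℝ) := by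
  let _ : MeasurableSpace ι := ⊤
  have h := ENNReal.lintegral_mul_le_Lp_mul_Lq (Measure.count : Measure ι)
    Real.HolderConjugate.two_two (f := u) (g := v) (measurable_from_top).aemeasurable
    (measurable_from_top).aemeasurable
  simpa [lintegral_count] using h

theorem tsum_sq_mul_sq_le {ι : Type*} (u v : ι → ℝ≥0∞) {S : ℝ≥0∞} (hu : ∑' i, u i ^ 4 ≤ S)
    (hv : ∑' i, v i ^ 4 ≤ S) : ∑' i, (u i * v i) ^ 2 ≤ S := by
  have h4 : ∀ x : ℝ≥0∞, (x ^ 2) ^ 2 = x ^ 4 := fun x => by rw [← pow_mul]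
  simp_rw [mul_pow]
  refine (tsum_mul_le_sqrt_mul_sqrt _ _).trans ?_
  simp_rw [h4]
  refine (mul_le_mul' (ENNReal.rpow_le_rpow hu (by norm_num))
    (ENNReal.rpow_le_rpow hv (by norm_num))).trans_eq ?_
  rw [← ENNReal.rpow_add_of_nonneg _ _ (by norm_num) (by norm_num)]
  norm_num

/-- In the variables `p = j - k`, `q = j - l`, `n = l - m` the kernel no longer depends on `j`. The
sum over `j` is of a product of four shifted sequences, bounded by Hölder (Cauchy–Schwarz twice)
uniformly in the shifts. -/
theorem tsum_four_le {a b : ℤ → ℝ≥0∞} (w : ℤ → ℝ≥0∞) :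
    ∑' (j : ℤ) (k : ℤ) (l : ℤ) (m : ℤ), a j * b k * (a l * b m) *
        (w (j - k) * w (j - l) * w (l - m)) ≤
      (∑' p, w p) ^ 3 * ((∑' j, a j ^ 4) ^ (1 / 2 : ℝ) * (∑' j, b j ^ 4) ^ (1 / 2 : ℝ)) := by
  set S := (∑' j, a j ^ 4) ^ (1 / 2 : ℝ) * (∑' j, b j ^ 4) ^ (1 / 2 : ℝ)
  have hshift : ∀ (u : ℤ → ℝ≥0∞) (e : ℤ ≃ ℤ), ∑' j, u (e j) ^ 4 ≤ ∑' j, u j ^ 4 :=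
    fun u e => (e.tsum_eq fun j => u j ^ 4).le
  have hfix : ∀ p q n : ℤ, ∑' j, a j * b (j - p) * (a (j - q) * b (j - q - n)) ≤ S := by
    intro p q n
    have h1 : ∀ j, a j * b (j - p) * (a (j - q) * b (j - q - n)) =
        a j * a (j - q) * (b (j - p) * b (j - q - n)) := fun j => by ring
    simp_rw [h1]
    refine (tsum_mul_le_sqrt_mul_sqrt _ _).trans ?_
    exact mul_le_mul'
      (ENNReal.rpow_le_rpow (tsum_sq_mul_sq_le _ _ le_rfl (hshift a (Equiv.subRight q)))
        (by norm_num))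
      (ENNReal.rpow_le_rpow (tsum_sq_mul_sq_le _ _ (hshift b (Equiv.subRight p))
        (hshift b ((Equiv.subRight q).trans (Equiv.subRight n)))) (by norm_num))
  calc _ = ∑' (j : ℤ) (p : ℤ) (q : ℤ) (n : ℤ), a j * b (j - p) * (a (j - q) * b (j - q - n)) *
        (w p * w q * w n) := by
        refine tsum_congr fun j => ?_
        rw [← (Equiv.subLeft j).tsum_eq]
        refine tsum_congr fun p => ?_
        rw [← (Equiv.subLeft j).tsum_eq]
        refine tsum_congr fun q => ?_
        rw [← (Equiv.subLeft (j - q)).tsum_eq]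
        refine tsum_congr fun n => ?_
        simp
    _ = ∑' (p : ℤ) (q : ℤ) (n : ℤ), (∑' j, a j * b (j - p) * (a (j - q) * b (j - q - n))) *
        (w p * w q * w n) := by
        rw [ENNReal.tsum_comm]
        refine tsum_congr fun p => ?_
        rw [ENNReal.tsum_comm]
        refine tsum_congr fun q => ?_
        rw [ENNReal.tsum_comm]
        refine tsum_congr fun n => ?_
        rw [ENNReal.tsum_mul_right]
    _ ≤ ∑' (p : ℤ) (q : ℤ) (n : ℤ), S * (w p * w q * w n) := by
        gcongr with p q n
        exact hfix p q n
    _ = _ := by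
        simp only [ENNReal.tsum_mul_left, ENNReal.tsum_mul_right]
        ring

/-! ### Comparison of the weights with the Lorentz norm -/

theorem pairwise_disjoint_Ioc_four_zpow :
    Pairwise (Function.onFun Disjoint fun j : ℤ => Set.Ioc ((4 : ℝ) ^ (j - 1)) (4 ^ j)) := by
  have h : Monotone fun j : ℤ => (4 : ℝ) ^ (j - 1) := fun i j hij =>
    zpow_le_zpow_right₀ (by norm_num) (by omega)
  simpa using h.pairwise_disjoint_on_Ioc_succ

/-- As `f*` decreases, it is at least `level f j` to the left of `4 ^ j`. With `r = 4 ^ j` the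
integral is at least `(r / 4)² * (1 / r) * (3 r / 4) = 3 r² / 64` times `level f j ^ 4`, and `32 * 3
/ 64 ≥ 1`. -/
theorem weight_pow_four_le {d : ℕ} (f : L2 d) (j : ℤ) :
    weight f j ^ 4 ≤ 32 * ∫⁻ t in Set.Ioc ((4 : ℝ) ^ (j - 1)) (4 ^ j),
      (ENNReal.ofReal (t ^ (1 / (2 : ℝ))) * decreasingRearrangement volume f t) ^ (4 : ℝ) *
        ENNReal.ofReal (1 / t) := by
  set r : ℝ := 4 ^ j with hr
  have hr0 : 0 < r := by positivity
  have hr1 : (4 : ℝ) ^ (j - 1) = r / 4 := by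
    rw [zpow_sub_one₀ (by norm_num), hr, div_eq_mul_inv]
  have hlow : ∀ t ∈ Set.Ioc (r / 4) r,
      (ENNReal.ofReal √(r / 4) * level f j) ^ 4 * ENNReal.ofReal (1 / r) ≤
      (ENNReal.ofReal (t ^ (1 / (2 : ℝ))) * decreasingRearrangement volume f t) ^ (4 : ℝ) *
        ENNReal.ofReal (1 / t) := by
    intro t ht
    have ht0 : 0 < t := lt_trans (by positivity) ht.1
    rw [← Real.sqrt_eq_rpow, ENNReal.rpow_ofNat]
    gcongr
    · exact ht.1.le
    · exact decreasingRearrangement_antitone ht.2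
    · exact ht.2
  have hw : weight f j ^ 4 = level f j ^ 4 * ENNReal.ofReal (r ^ 2) := by
    rw [weight, ENNReal.ofReal_pow hr0.le, ofReal_four_zpow, four_zpow_eq]
    ring
  have hc : (32 : ℝ≥0∞) = ENNReal.ofReal 32 := by simp
  have hint : level f j ^ 4 * ENNReal.ofReal (r ^ 2 * (3 / 64)) ≤
      ∫⁻ t in Set.Ioc (r / 4) r,
        (ENNReal.ofReal (t ^ (1 / (2 : ℝ))) * decreasingRearrangement volume f t) ^ (4 : ℝ) *
          ENNReal.ofReal (1 / t) := by
    refine le_trans (le_of_eq ?_) (setLIntegral_mono' measurableSet_Ioc hlow)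
    have hs : √(r / 4) ^ 4 = (r / 4) ^ 2 := by
      rw [show 4 = 2 * 2 from rfl, pow_mul, Real.sq_sqrt (by positivity)]
    rw [setLIntegral_const, Real.volume_Ioc, mul_pow, ← ENNReal.ofReal_pow (Real.sqrt_nonneg _), hs,
      mul_comm (ENNReal.ofReal _) (level f j ^ 4), mul_assoc, mul_assoc,
      ← ENNReal.ofReal_mul (by positivity), ← ENNReal.ofReal_mul (by positivity)]
    congr 2
    field_simp
    norm_num
  rw [hr1, hw, hc]
  calc level f j ^ 4 * ENNReal.ofReal (r ^ 2)
      ≤ level f j ^ 4 * ENNReal.ofReal (32 * (r ^ 2 * (3 / 64))) := by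
        gcongr
        nlinarith
    _ = ENNReal.ofReal 32 * (level f j ^ 4 * ENNReal.ofReal (r ^ 2 * (3 / 64))) := by
        rw [ENNReal.ofReal_mul (by norm_num)]
        ring
    _ ≤ _ := by gcongr

theorem tsum_weight_pow_le {d : ℕ} (f : L2 d) :
    ∑' j, weight f j ^ 4 ≤ 16 * lorentzNorm 2 4 volume f ^ 4 := by
  have h4 : lorentzNorm 2 4 volume f ^ 4 = 2 * ∫⁻ t in Set.Ioi (0 : ℝ),
      (ENNReal.ofReal (t ^ (1 / (2 : ℝ))) * decreasingRearrangement volume f t) ^ (4 : ℝ) *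
        ENNReal.ofReal (1 / t) := by
    rw [lorentzNorm, ← ENNReal.rpow_natCast, ← ENNReal.rpow_mul]
    norm_num
  calc ∑' j, weight f j ^ 4
      ≤ ∑' j : ℤ, 32 * ∫⁻ t in Set.Ioc ((4 : ℝ) ^ (j - 1)) (4 ^ j),
      (ENNReal.ofReal (t ^ (1 / (2 : ℝ))) * decreasingRearrangement volume f t) ^ (4 : ℝ) *
        ENNReal.ofReal (1 / t) := ENNReal.tsum_le_tsum fun j => weight_pow_four_le f j
    _ ≤ 32 * ∫⁻ t in Set.Ioi (0 : ℝ),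
      (ENNReal.ofReal (t ^ (1 / (2 : ℝ))) * decreasingRearrangement volume f t) ^ (4 : ℝ) *
        ENNReal.ofReal (1 / t) := by
        rw [ENNReal.tsum_mul_left,
          ← lintegral_iUnion (fun _ => measurableSet_Ioc) pairwise_disjoint_Ioc_four_zpow]
        gcongr
        refine Set.iUnion_subset fun j t ht => lt_trans ?_ ht.1
        positivity
    _ = _ := by
        rw [h4, ← mul_assoc]
        norm_num

/-! ### Expansion of the square and passage to the limit -/

theorem sq_enorm_radialProj_tensor_sum_le {d : ℕ} (f g : L2 d) (s : Finset ℤ) :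
    ‖radialProj d (tensor (∑ j ∈ s, piece f j) (∑ k ∈ s, piece g k))‖ₑ ^ 2 ≤
      ∑' (j : ℤ) (k : ℤ) (l : ℤ) (m : ℤ),
        ‖inner ℂ (radialProj d (tensor (piece f j) (piece g k)))
          (radialProj d (tensor (piece f l) (piece g m)))‖ₑ := by
  have h : radialProj d (tensor (∑ j ∈ s, piece f j) (∑ k ∈ s, piece g k)) =
      ∑ j ∈ s, ∑ k ∈ s, radialProj d (tensor (piece f j) (piece g k)) := by
    simp only [← tensorCLM_apply, map_sum, sum_apply]
    rw [Finset.sum_comm]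
  rw [← enorm_inner_self, h, sum_inner]
  refine (enorm_sum_le _ _).trans (le_trans (Finset.sum_le_sum fun j _ => ?_)
    (ENNReal.sum_le_tsum s))
  rw [sum_inner]
  refine (enorm_sum_le _ _).trans (le_trans (Finset.sum_le_sum fun k _ => ?_)
    (ENNReal.sum_le_tsum s))
  rw [inner_sum]
  refine (enorm_sum_le _ _).trans (le_trans (Finset.sum_le_sum fun l _ => ?_)
    (ENNReal.sum_le_tsum s))
  rw [inner_sum]
  exact (enorm_sum_le _ _).trans (ENNReal.sum_le_tsum s)

theorem sq_enorm_radialProj_tensor_le {d : ℕ} (f g : L2 d) {κ : ℝ≥0} (hκ : κ < 1)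
    (hκ2 : κ ^ (2 * (d + 1)) = 1 / 2) :
    ‖radialProj d (tensor f g)‖ₑ ^ 2 ≤
      2 ^ (2 * (d + 4)) * (∑' p : ℤ, (κ : ℝ≥0∞) ^ p.natAbs) ^ 3 * 16 *
        (lorentzNorm 2 4 volume f * lorentzNorm 2 4 volume g) ^ 2 := by
  have hlim : Tendsto (fun n : ℕ => ‖radialProj d (tensorCLM d
      (∑ j ∈ Finset.Ico (-(n : ℤ)) n, piece f j) (∑ j ∈ Finset.Ico (-(n : ℤ)) n, piece g j))‖ₑ ^ 2)
      atTop (𝓝 (‖radialProj d (tensorCLM d f g)‖ₑ ^ 2)) := by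
    have h2 := ((tensorCLM d).continuous₂.tendsto (f, g)).comp
      ((tendsto_sum_piece f).prodMk_nhds (tendsto_sum_piece g))
    have h3 := (((radialProj d).continuous.tendsto _).comp h2).enorm
    exact ENNReal.Tendsto.pow h3
  have hroot : ∀ h : L2 d, (∑' j, weight h j ^ 4) ^ (1 / 2 : ℝ) ≤
      4 * lorentzNorm 2 4 volume h ^ 2 := by
    intro h
    refine (ENNReal.rpow_le_rpow (tsum_weight_pow_le h) (by norm_num)).trans_eq ?_
    have h2 : 16 * lorentzNorm 2 4 volume h ^ 4 = (4 * lorentzNorm 2 4 volume h ^ 2) ^ 2 := by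
      ring
    rw [h2, ← ENNReal.rpow_natCast, ← ENNReal.rpow_mul]
    norm_num
  -- The bound on the truncated sums is independent of `n`, so it survives the limit.
  refine le_of_tendsto' hlim fun n => (sq_enorm_radialProj_tensor_sum_le f g _).trans ?_
  calc _ ≤ ∑' (j : ℤ) (k : ℤ) (l : ℤ) (m : ℤ), 2 ^ (2 * (d + 4)) *
        (weight f j * weight g k * (weight f l * weight g m) *
        ((κ : ℝ≥0∞) ^ (j - k).natAbs * κ ^ (j - l).natAbs * κ ^ (l - m).natAbs)) := by
        refine ENNReal.tsum_le_tsum fun j => ENNReal.tsum_le_tsum fun k =>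
          ENNReal.tsum_le_tsum fun l => ENNReal.tsum_le_tsum fun m => ?_
        rw [← mul_assoc]
        exact enorm_inner_radialProj_tensor_piece_le_pow f g hκ hκ2 j k l m
    _ ≤ 2 ^ (2 * (d + 4)) * ((∑' p : ℤ, (κ : ℝ≥0∞) ^ p.natAbs) ^ 3 *
        ((∑' j, weight f j ^ 4) ^ (1 / 2 : ℝ) * (∑' j, weight g j ^ 4) ^ (1 / 2 : ℝ))) := by
        simp only [ENNReal.tsum_mul_left (a := 2 ^ (2 * (d + 4)))]
        exact mul_le_mul_right (tsum_four_le fun p : ℤ => (κ : ℝ≥0∞) ^ p.natAbs) _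
    _ ≤ 2 ^ (2 * (d + 4)) * ((∑' p : ℤ, (κ : ℝ≥0∞) ^ p.natAbs) ^ 3 *
        ((4 * lorentzNorm 2 4 volume f ^ 2) * (4 * lorentzNorm 2 4 volume g ^ 2))) := by
        gcongr
        · exact hroot f
        · exact hroot g
    _ = _ := by ring

end NearlyRadial

theorem corollary3p5 (d : ℕ) (hd : 1 ≤ d) :
    ∃ C : ℝ≥0, ∀ f g : NearlyRadial.L2 d,
      ‖NearlyRadial.radialProj d (NearlyRadial.tensor f g)‖ₑ ≤
        C * NearlyRadial.lorentzNorm 2 4 volume f * NearlyRadial.lorentzNorm 2 4 volume g := by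
  obtain ⟨κ, hκ, hκ2⟩ := NearlyRadial.exists_pow_eq_half d
  set K := 2 ^ (2 * (d + 4)) * (∑' p : ℤ, (κ : ℝ≥0∞) ^ p.natAbs) ^ 3 * 16 with hK
  have hKt : K ^ (1 / 2 : ℝ) ≠ ⊤ :=
    ENNReal.rpow_ne_top_of_nonneg (by norm_num) (ENNReal.mul_ne_top (ENNReal.mul_ne_top
      (ENNReal.pow_ne_top (by simp))
      (ENNReal.pow_ne_top (NearlyRadial.tsum_int_pow_natAbs_ne_top hκ))) (by simp))
  refine ⟨(K ^ (1 / 2 : ℝ)).toNNReal, fun f g => ?_⟩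
  rw [ENNReal.coe_toNNReal hKt, mul_assoc]
  refine (ENNReal.pow_le_pow_left_iff (n := 2) two_ne_zero).1 ?_
  refine (NearlyRadial.sq_enorm_radialProj_tensor_le f g hκ hκ2).trans_eq ?_
  rw [mul_pow _ (NearlyRadial.lorentzNorm _ _ _ _ * _), ← ENNReal.rpow_natCast (K ^ _),
    ← ENNReal.rpow_mul]
  norm_num [hK]
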